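/- Let $n\ge 0$ and $d\ge 1$ be integers, let $\mathbb R[x]_{=d}$ be the space of real homogeneous polynomials of degree $d$ in $x=(x_1,\dots,x_n)$, identified with the space of coefficient vectors, and let $\mathbb S^{n-1}=\{x\in\mathbb R^n: x_1^2+\cdots+x_n^2=1\}$. For $f\in\mathbb R[x]_{=d}$ call $x\in\mathbb S^{n-1}$ an SONC point (resp. an SOSC point) of the problem $\min_{x\in\mathbb S^{n-1}} f(x)$ if there is $\lambda\in\mathbb R$ with $\nabla f(x)-\lambda x=0$ and $u^T\nabla^2 f(x)u-\lambda\ge 0$ (resp. $>0$) for all $u\in\mathbb S^{n-1}$ with $u^Tx=0$. Consider the system $$\operatorname{rank}\begin{bmatrix}\nabla f(x)& x&0\\ \nabla^2 f(x)y& y& x\end{bmatrix}\le 2,\qquad y^Tx=0\qquad(\ast)$$ in $(x,y)\in\mathbb C^n\times\mathbb C^n$. Elimination polynomials for $(\ast)$ are finitely many homogeneous polynomials $\phi_1,\dots,\phi_s$ with integer coefficients in the coefficients of $f$ such that, for every $f\in\mathbb R[x]_{=d}$, $(\ast)$ has a solution with $x\neq 0$ and $y\ne 0$ if and only if $\phi_1(f)=\cdots=\phi_s(f)=0$.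 **Theorem.** Elimination polynomials for $(\ast)$ exist. For any choice of them let $\phi=\phi_1^2+\cdots+\phi_s^2$. Then: 1. $\phi$ does not vanish identically, and $\{f\in\mathbb R[x]_{=d}:\phi(f)=0\}$ has Lebesgue measure zero. 2. If $f\in\mathbb R[x]_{=d}$ and $\phi(f)\neq 0$, then every SONC point of $\min_{\mathbb S^{n-1}} f$ is an SOSC point and a local minimizer of $f$ on $\mathbb S^{n-1}$. Consequently, for all $f\in\mathbb R[x]_{=d}$ outside a set of Lebesgue measure zero, every SONC point of $\min_{\mathbb S^{n-1}} f$ is an SOSC point and a local minimizer of $f$ on $\mathbb S^{n-1}$. -/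

import Mathlib

open MvPolynomial MeasureTheory

noncomputable section

namespace SphereOpt

/-- The exponents of the monomials of degree `d` in `n` variables. They index the coefficients of a
form of degree `d`. -/
abbrev FormIndex (n d : ℕ) : Type :=
  ↥(Finset.finsuppAntidiag (Finset.univ : Finset (Fin n)) d)

/-- The form of degree `d` with given coefficients: a linear bijection from `ℝ^(FormIndex n d)` to
the space of real forms of degree `d`, with inverse `coeffVec d`. -/
def formOf {n d : ℕ} (a : FormIndex n d → ℝ) : MvPolynomial (Fin n) ℝ :=
  ∑ m : FormIndex n d, monomial (m : Fin n →₀ ℕ) (a m)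

/-- The vector of the coefficients of `f` at the monomials of degree `d`. -/
def coeffVec {n : ℕ} (d : ℕ) (f : MvPolynomial (Fin n) ℝ) : FormIndex n d → ℝ :=
  fun m => coeff (m : Fin n →₀ ℕ) f

/-- The gradient of a polynomial at a point. -/
def grad {n : ℕ} {K : Type*} [Field K] (f : MvPolynomial (Fin n) K) (x : Fin n → K) : Fin n → K :=
  fun i => eval x (pderiv i f)

/-- The Hessian matrix of a polynomial at a point. -/
def hess {n : ℕ} {K : Type*} [Field K] (f : MvPolynomial (Fin n) K) (x : Fin n → K) :
    Matrix (Fin n) (Fin n) K :=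
  Matrix.of fun i j => eval x (pderiv i (pderiv j f))

/-- The Euclidean unit sphere of `ℝ^n`. -/
def unitSphere (n : ℕ) : Set (Fin n → ℝ) := {x | ∑ i, x i ^ 2 = 1}

/-- `x` lies on the unit sphere and satisfies, with a multiplier `l`, the first order necessary
condition and the second order necessary condition for the minimization of `f` on the sphere. -/
def IsSONCPoint {n : ℕ} (f : MvPolynomial (Fin n) ℝ) (x : Fin n → ℝ) : Prop :=
  x ∈ unitSphere n ∧ ∃ l : ℝ, grad f x - l • x = 0 ∧
    ∀ u ∈ unitSphere n, u ⬝ᵥ x = 0 → 0 ≤ u ⬝ᵥ (hess f x).mulVec u - l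

/-- `x` lies on the unit sphere and satisfies, with a multiplier `l`, the first order necessary
condition and the second order sufficient condition for the minimization of `f` on the sphere. -/
def IsSOSCPoint {n : ℕ} (f : MvPolynomial (Fin n) ℝ) (x : Fin n → ℝ) : Prop :=
  x ∈ unitSphere n ∧ ∃ l : ℝ, grad f x - l • x = 0 ∧
    ∀ u ∈ unitSphere n, u ⬝ᵥ x = 0 → 0 < u ⬝ᵥ (hess f x).mulVec u - l

/-- `x` is a local minimizer of `f` on the unit sphere. -/
def IsLocalMinimizer {n : ℕ} (f : MvPolynomial (Fin n) ℝ) (x : Fin n → ℝ) : Prop :=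
  x ∈ unitSphere n ∧ IsLocalMinOn (fun z => eval z f) (unitSphere n) x

/-- The `2n × 3` matrix with the block rows `(∇f(x), x, 0)` and `(∇²f(x) y, y, x)`. -/
def rankMatrix {n : ℕ} (f : MvPolynomial (Fin n) ℂ) (x y : Fin n → ℂ) :
    Matrix (Fin n ⊕ Fin n) (Fin 3) ℂ :=
  Matrix.of (Sum.elim
    (fun i => ![grad f x i, x i, 0])
    (fun i => ![(hess f x).mulVec y i, y i, x i]))

/-- The rank system of the real polynomial `f` has a complex solution `(x, y)` with `x ≠ 0` and
`y ≠ 0`. The product `y ⬝ᵥ x` is bilinear, without conjugation. -/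
def RankSystemSolvable {n : ℕ} (f : MvPolynomial (Fin n) ℝ) : Prop :=
  ∃ x y : Fin n → ℂ, x ≠ 0 ∧ y ≠ 0 ∧
    (rankMatrix (map (algebraMap ℝ ℂ) f) x y).rank ≤ 2 ∧ y ⬝ᵥ x = 0

/-- `g 0, …, g (s - 1)` are elimination polynomials for the rank system: they are polynomials with
integer coefficients in the coefficients of a form of degree `d`, each of them homogeneous, and
they vanish simultaneously at exactly those real forms of degree `d` whose rank system has a
solution in `ℂ^n × ℂ^n` with both components nonzero. -/
def IsEliminationFamily {n d s : ℕ} (g : Fin s → MvPolynomial (FormIndex n d) ℤ) : Prop :=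
  (∀ i, ∃ k : ℕ, (g i).IsHomogeneous k) ∧
    ∀ f : MvPolynomial (Fin n) ℝ, f.IsHomogeneous d →
      (RankSystemSolvable f ↔ ∀ i, aeval (coeffVec d f) (g i) = 0)

/-- The sum of the squares of a finite family of polynomials. -/
def sumSquares {n d s : ℕ} (g : Fin s → MvPolynomial (FormIndex n d) ℤ) :
    MvPolynomial (FormIndex n d) ℤ :=
  ∑ i, g i ^ 2

end SphereOpt

end

/-! At an SONC point with multiplier `l` the quadratic form of `∇²f(x) - l` is nonnegative on the
tangent space. If SOSC fails, it vanishes at a unit tangent vector `u`, which then lies in its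
kernel: `∇²f(x)u - l u` is a multiple of `x`, and `(x, u)` solves the rank system
(`IsSONCPoint.isSOSCPoint`). So an unsolvable system turns SONC into SOSC, and SOSC gives local
minimality by compactness of the set of directions.

For `x ≠ 0` the system amounts to the bihomogeneous equations `rankEq`. By the Nullstellensatz these
have no solution with `x, y ≠ 0` exactly when, for some `N`, their monomial multiples span all of
bidegree `(N, N)`. The determinants `minor` that test this are integer polynomials in the
coefficients of `f`. Solvability survives scaling of `f`, so they can be replaced by their
homogeneous components, of which Hilbert's basis theorem keeps finitely many.

A suitable diagonal form has an unsolvable system (`exists_not_rankSystemSolvable`), so some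
elimination polynomial is nonzero at a real point, and its real zero set is null. -/

namespace SphereOpt

/-! ### Second order optimality conditions on the sphere -/

section SecondOrder

open Filter Topology

variable {n : ℕ}

theorem hasDerivAt_eval_line (f : MvPolynomial (Fin n) ℝ) (x w : Fin n → ℝ) (t : ℝ) :
    HasDerivAt (fun t : ℝ => eval (x + t • w) f) (w ⬝ᵥ grad f (x + t • w)) t := by
  induction f using MvPolynomial.induction_on with
  | C a => simpa [grad, dotProduct] using hasDerivAt_const t a
  | add p q hp hq =>
    simp only [map_add]
    refine (hp.fun_add hq).congr_deriv ?_
    simp only [grad, map_add, dotProduct, ← Finset.sum_add_distrib, mul_add]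
  | mul_X p i hp =>
    have hX : HasDerivAt (fun t : ℝ => x i + t * w i) (w i) t := by
      simpa using ((hasDerivAt_id t).mul_const (w i)).const_add (x i)
    simp only [map_mul, eval_X, Pi.add_apply, Pi.smul_apply, smul_eq_mul]
    refine (hp.fun_mul hX).congr_deriv ?_
    have hs : ∑ j, w j * (eval (x + t • w) p * eval (x + t • w)
        (Pi.single (M := fun _ => MvPolynomial (Fin n) ℝ) j 1 i)) = eval (x + t • w) p * w i := by
      rw [Finset.sum_eq_single i]
      · simp [mul_comm]
      · intro j _ hj
        simp [hj.symm]
      · simp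
    simp only [grad, dotProduct, pderiv_mul, pderiv_X, map_add, map_mul, eval_X, Pi.add_apply,
      Pi.smul_apply, smul_eq_mul, mul_add (w _), Finset.sum_add_distrib, hs, Finset.sum_mul,
      mul_assoc]

theorem hasDerivAt_grad_line (f : MvPolynomial (Fin n) ℝ) (x w : Fin n → ℝ) (t : ℝ) :
    HasDerivAt (fun t : ℝ => w ⬝ᵥ grad f (x + t • w))
      (w ⬝ᵥ (hess f (x + t • w)).mulVec w) t := by
  have h := HasDerivAt.fun_sum (u := Finset.univ) fun j _ =>
    (hasDerivAt_eval_line (pderiv j f) x w t).const_mul (w j)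
  refine h.congr_deriv ?_
  simp only [dotProduct, Matrix.mulVec, hess, grad, Matrix.of_apply, Finset.mul_sum]
  rw [Finset.sum_comm]
  exact Finset.sum_congr rfl fun j _ => Finset.sum_congr rfl fun i _ => by ring

/-- A function with vanishing derivative at `0` that decreases from `0` to `1` has a negative
second derivative in between. -/
theorem exists_second_deriv_neg {h h' h'' : ℝ → ℝ} (h1 : ∀ t, HasDerivAt h (h' t) t)
    (h2 : ∀ t, HasDerivAt h' (h'' t) t) (h0 : h' 0 = 0) (hlt : h 1 < h 0) :
    ∃ t ∈ Set.Ioo (0 : ℝ) 1, h'' t < 0 := by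
  obtain ⟨c, hc, hc'⟩ := exists_hasDerivAt_eq_slope h h' zero_lt_one
    (fun t _ => (h1 t).continuousAt.continuousWithinAt) fun t _ => h1 t
  obtain ⟨e, he, he'⟩ := exists_hasDerivAt_eq_slope h' h'' hc.1
    (fun t _ => (h2 t).continuousAt.continuousWithinAt) fun t _ => h2 t
  refine ⟨e, ⟨he.1, he.2.trans hc.2⟩, ?_⟩
  rw [he', h0]
  apply div_neg_of_neg_of_pos
  · rw [hc']; linarith
  · linarith [hc.1]

/-- Along the chord from `x` to `z` the Lagrangian `f - l (|·|² - 1) / 2` is stationary at `x`. Its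
multiplier term vanishes at both ends because they are unit vectors, so it decreases and must have a
negative second derivative in between. -/
theorem exists_hess_lt_of_eval_lt {f : MvPolynomial (Fin n) ℝ} {x z : Fin n → ℝ} {l : ℝ}
    (hx : x ⬝ᵥ x = 1) (hz : z ⬝ᵥ z = 1) (hg : grad f x = l • x) (hlt : eval z f < eval x f) :
    ∃ t ∈ Set.Ioo (0 : ℝ) 1, (z - x) ⬝ᵥ (hess f (x + t • (z - x))).mulVec (z - x)
      - l * ((z - x) ⬝ᵥ (z - x)) < 0 := by
  set w := z - x with hw
  have hwx : 2 * (w ⬝ᵥ x) = - (w ⬝ᵥ w) := by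
    simp only [hw, sub_dotProduct, dotProduct_sub, hx, hz, dotProduct_comm x z]; ring
  refine exists_second_deriv_neg
    (h := fun t => eval (x + t • w) f - l * (t * (w ⬝ᵥ x) + t ^ 2 / 2 * (w ⬝ᵥ w)))
    (h' := fun t => w ⬝ᵥ grad f (x + t • w) - l * (w ⬝ᵥ x + t * (w ⬝ᵥ w))) ?_ ?_ ?_ ?_
  · intro t
    refine (hasDerivAt_eval_line f x w t).sub (HasDerivAt.const_mul l ?_)
    have ha := (hasDerivAt_id t).mul_const (w ⬝ᵥ x)
    have hb := (((hasDerivAt_id t).pow 2).div_const 2).mul_const (w ⬝ᵥ w)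
    refine (ha.fun_add hb).congr_deriv ?_
    simp
  · intro t
    refine (hasDerivAt_grad_line f x w t).sub (HasDerivAt.const_mul l ?_)
    simpa using ((hasDerivAt_id t).mul_const (w ⬝ᵥ w)).const_add (w ⬝ᵥ x)
  · simp [hg]
  · have : x + (1 : ℝ) • w = z := by simp [hw]
    simp only [this]
    simp only [zero_smul, add_zero]
    have : 1 * (w ⬝ᵥ x) + 1 ^ 2 / 2 * (w ⬝ᵥ w) = 0 := by linarith
    rw [this]
    simpa using hlt

theorem mem_unitSphere_iff {x : Fin n → ℝ} : x ∈ unitSphere n ↔ x ⬝ᵥ x = 1 := by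
  simp [unitSphere, dotProduct, sq]

theorem dotProduct_self_pos_of_ne_zero {v : Fin n → ℝ} (hv : v ≠ 0) : 0 < v ⬝ᵥ v :=
  lt_of_le_of_ne (Finset.sum_nonneg fun _ _ => mul_self_nonneg _)
    fun h => hv (dotProduct_self_eq_zero.1 h.symm)

/-- Every nonzero vector is a positive multiple of a unit vector. -/
theorem exists_unit_smul {v : Fin n → ℝ} (hv : v ≠ 0) :
    ∃ u ∈ unitSphere n, ∃ c : ℝ, 0 < c ∧ v = c • u := by
  have h := dotProduct_self_pos_of_ne_zero hv
  have hs := Real.sqrt_pos.2 h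
  refine ⟨(√(v ⬝ᵥ v))⁻¹ • v, ?_, √(v ⬝ᵥ v), hs, ?_⟩
  · rw [mem_unitSphere_iff, smul_dotProduct, dotProduct_smul, smul_eq_mul, smul_eq_mul]
    nth_rw 3 [← Real.mul_self_sqrt h.le]
    field_simp
  · rw [smul_smul, mul_inv_cancel₀ hs.ne', one_smul]

theorem quadForm_smul (H : Matrix (Fin n) (Fin n) ℝ) (l c : ℝ) (u : Fin n → ℝ) :
    (c • u) ⬝ᵥ H.mulVec (c • u) - l * ((c • u) ⬝ᵥ (c • u))
      = c ^ 2 * (u ⬝ᵥ H.mulVec u - l * (u ⬝ᵥ u)) := by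
  simp only [Matrix.mulVec_smul, smul_dotProduct, dotProduct_smul, smul_eq_mul]; ring

theorem continuous_hess_line (f : MvPolynomial (Fin n) ℝ) (l : ℝ) :
    Continuous fun p : (Fin n → ℝ) × (Fin n → ℝ) =>
      p.2 ⬝ᵥ (hess f p.1).mulVec p.2 - l * (p.2 ⬝ᵥ p.2) := by
  have h : ∀ g : MvPolynomial (Fin n) ℝ,
      Continuous fun p : (Fin n → ℝ) × (Fin n → ℝ) => eval p.1 g := fun g =>
    (MvPolynomial.continuous_eval g).comp continuous_fst
  have h2 : ∀ i, Continuous fun p : (Fin n → ℝ) × (Fin n → ℝ) => p.2 i := fun i =>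
    (continuous_apply i).comp continuous_snd
  simp only [dotProduct, Matrix.mulVec, hess, Matrix.of_apply]
  refine Continuous.sub (continuous_finsetSum _ fun i _ => (h2 i).mul
    (continuous_finsetSum _ fun j _ => (h _).mul (h2 j))) (continuous_const.mul
    (continuous_finsetSum _ fun i _ => (h2 i).mul (h2 i)))

/-- The second order sufficient condition implies local minimality on the sphere. -/
theorem IsSOSCPoint.isLocalMinimizer {f : MvPolynomial (Fin n) ℝ} {x : Fin n → ℝ}
    (h : IsSOSCPoint f x) : IsLocalMinimizer f x := by
  obtain ⟨hxS, l, hg, hpos⟩ := h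
  have hx := mem_unitSphere_iff.1 hxS
  rw [sub_eq_zero] at hg
  refine ⟨hxS, ?_⟩
  by_contra hmin
  have hfreq : ∃ᶠ z in 𝓝[unitSphere n] x, eval z f < eval x f := by
    simpa only [IsLocalMinOn, IsMinFilter, Filter.not_eventually, not_le] using hmin
  obtain ⟨z, hz, hzlt⟩ := exists_seq_forall_of_frequently
    (hfreq.and_eventually eventually_mem_nhdsWithin)
  have hzx : Tendsto z atTop (𝓝 x) := tendsto_nhds_of_tendsto_nhdsWithin hz
  choose t ht hneg using fun k =>
    exists_hess_lt_of_eval_lt hx (mem_unitSphere_iff.1 (hzlt k).2) hg (hzlt k).1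
  have hw0 : ∀ k, z k - x ≠ 0 := fun k h0 => by
    have := (hzlt k).1
    rw [sub_eq_zero.1 h0] at this
    exact lt_irrefl _ this
  have hnorm : Tendsto (fun k => ‖z k - x‖) atTop (𝓝 0) := by
    simpa using (hzx.sub_const x).norm
  -- This is the sup norm of `Fin n → ℝ`, so the limit direction `v` is nonzero but need not be a
  -- Euclidean unit vector.
  have hmem : ∀ k, ‖z k - x‖⁻¹ • (z k - x) ∈ Metric.sphere (0 : Fin n → ℝ) 1 := fun k => by
    simp [norm_smul, norm_ne_zero_iff.2 (hw0 k)]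
  obtain ⟨v, hv, φ, hφ, hlim⟩ := (isCompact_sphere (0 : Fin n → ℝ) 1).tendsto_subseq hmem
  have hv0 : v ≠ 0 := by
    rintro rfl
    simp at hv
  -- For `w = z k - x` the product `w ⬝ᵥ x = -(w ⬝ᵥ w) / 2` is of second order in `w`, so the limit
  -- direction is tangent.
  have hvx : v ⬝ᵥ x = 0 := by
    have hdot : Continuous fun p : (Fin n → ℝ) × (Fin n → ℝ) => p.1 ⬝ᵥ p.2 :=
      continuous_fst.dotProduct continuous_snd
    have h1 := (hdot.tendsto (v, x)).comp (hlim.prodMk_nhds tendsto_const_nhds)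
    have h2 := ((hnorm.comp hφ.tendsto_atTop).mul
      ((hdot.tendsto (v, v)).comp (hlim.prodMk_nhds hlim))).const_mul (-1 / 2)
    rw [zero_mul, mul_zero] at h2
    refine tendsto_nhds_unique (h1.congr fun k => ?_) h2
    have hne := norm_ne_zero_iff.2 (hw0 (φ k))
    have hzk := mem_unitSphere_iff.1 (hzlt (φ k)).2
    have hwx : (z (φ k) - x) ⬝ᵥ x = -1 / 2 * ((z (φ k) - x) ⬝ᵥ (z (φ k) - x)) := by
      simp only [sub_dotProduct, dotProduct_sub, hx, hzk, dotProduct_comm x (z (φ k))]; ring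
    simp only [Function.comp, smul_dotProduct, dotProduct_smul, smul_eq_mul, hwx]
    field_simp
  have hpt : Tendsto (fun k => x + t (φ k) • (z (φ k) - x)) atTop (𝓝 x) := by
    have : Tendsto (fun k => t k • (z k - x)) atTop (𝓝 0) := by
      refine squeeze_zero_norm (fun k => ?_) hnorm
      rw [norm_smul, Real.norm_of_nonneg (ht k).1.le]
      exact mul_le_of_le_one_left (norm_nonneg _) (ht k).2.le
    simpa using (this.comp hφ.tendsto_atTop).const_add x
  have hle : v ⬝ᵥ (hess f x).mulVec v - l * (v ⬝ᵥ v) ≤ 0 := by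
    refine le_of_tendsto (((continuous_hess_line f l).tendsto (x, v)).comp
      (hpt.prodMk_nhds hlim)) (Eventually.of_forall fun k => ?_)
    simp only [Function.comp]
    rw [quadForm_smul]
    exact mul_nonpos_of_nonneg_of_nonpos (sq_nonneg _) (hneg (φ k)).le
  obtain ⟨u, hu, c, hc, rfl⟩ := exists_unit_smul hv0
  have hux : u ⬝ᵥ x = 0 := by
    simpa [smul_dotProduct, hc.ne'] using hvx
  rw [quadForm_smul, mem_unitSphere_iff.1 hu, mul_one] at hle
  have := mul_pos (pow_pos hc 2) (hpos u hu hux)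
  linarith

/-- The commutator of two derivations is a derivation, and this one kills every variable. -/
theorem pderiv_comm {R : Type*} [CommRing R] (f : MvPolynomial (Fin n) R) (i j : Fin n) :
    pderiv i (pderiv j f) = pderiv j (pderiv i f) := by
  have h : ⁅pderiv (R := R) i, pderiv (R := R) j⁆ = 0 := by
    refine MvPolynomial.derivation_ext fun k => ?_
    simp only [Derivation.commutator_apply, pderiv_X, Derivation.coe_zero, Pi.zero_apply,
      Pi.single_apply]
    split_ifs <;> simp
  have h1 := congr($h f)
  rwa [Derivation.commutator_apply, Derivation.coe_zero, Pi.zero_apply, sub_eq_zero] at h1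

theorem hess_isSymm {K : Type*} [Field K] (f : MvPolynomial (Fin n) K) (x : Fin n → K) :
    (hess f x).IsSymm := by
  ext i j
  simp only [hess, Matrix.transpose_apply, Matrix.of_apply]
  rw [pderiv_comm]

/-- At a point satisfying the second order necessary but not the second order sufficient condition,
the Hessian of the Lagrangian maps some unit tangent vector to a multiple of the point. -/
theorem IsSONCPoint.exists_of_not_isSOSCPoint {f : MvPolynomial (Fin n) ℝ} {x : Fin n → ℝ}
    (h : IsSONCPoint f x) (h' : ¬ IsSOSCPoint f x) :
    ∃ (l m : ℝ) (u : Fin n → ℝ), u ≠ 0 ∧ u ⬝ᵥ x = 0 ∧ grad f x = l • x ∧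
      (hess f x).mulVec u = l • u + m • x := by
  obtain ⟨hxS, l, hg, hnn⟩ := h
  have hx := mem_unitSphere_iff.1 hxS
  obtain ⟨u, hu, hux, hle⟩ : ∃ u ∈ unitSphere n, u ⬝ᵥ x = 0 ∧
      u ⬝ᵥ (hess f x).mulVec u - l ≤ 0 := by
    by_contra hcon
    push Not at hcon
    exact h' ⟨hxS, l, hg, hcon⟩
  have hu1 := mem_unitSphere_iff.1 hu
  have hnn' : ∀ v : Fin n → ℝ, v ⬝ᵥ x = 0 →
      0 ≤ v ⬝ᵥ (hess f x).mulVec v - l * (v ⬝ᵥ v) := by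
    intro v hv
    rcases eq_or_ne v 0 with rfl | hv0
    · simp
    obtain ⟨u, hu, c, hc, rfl⟩ := exists_unit_smul hv0
    rw [quadForm_smul, mem_unitSphere_iff.1 hu, mul_one]
    refine mul_nonneg (sq_nonneg _) (hnn u hu ?_)
    simpa [smul_dotProduct, hc.ne'] using hv
  set z := (hess f x).mulVec u - l • u with hz
  have hzv : ∀ v : Fin n → ℝ, v ⬝ᵥ x = 0 → v ⬝ᵥ z = 0 := by
    intro v hv
    have hsymm : u ⬝ᵥ (hess f x).mulVec v = v ⬝ᵥ (hess f x).mulVec u := by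
      rw [Matrix.dotProduct_mulVec, ← Matrix.mulVec_transpose, hess_isSymm, dotProduct_comm]
    -- The form at `u + t • v` is nonnegative and its constant term, the value at `u`, is at most
    -- zero. With that term dropped, the discriminant forces the linear coefficient to vanish.
    have key : ∀ t : ℝ, 0 ≤ (v ⬝ᵥ (hess f x).mulVec v - l * (v ⬝ᵥ v)) * (t * t)
        + (2 * (v ⬝ᵥ z)) * t + 0 := by
      intro t
      have := hnn' (u + t • v) (by simp [add_dotProduct, smul_dotProduct, hux, hv])
      simp only [Matrix.mulVec_add, Matrix.mulVec_smul, add_dotProduct, dotProduct_add,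
        smul_dotProduct, dotProduct_smul, smul_eq_mul, hu1, hsymm, dotProduct_comm u v] at this
      simp only [hz, dotProduct_sub, dotProduct_smul, smul_eq_mul]
      nlinarith [hle]
    have hd := discrim_le_zero key
    rw [discrim] at hd
    nlinarith [sq_nonneg (v ⬝ᵥ z)]
  refine ⟨l, z ⬝ᵥ x, u, ?_, hux, sub_eq_zero.1 hg, ?_⟩
  · rintro rfl
    simp at hu1
  -- The tangential part of `z` is orthogonal both to `z` and to `x`, hence to itself.
  · have hvx : (z - (z ⬝ᵥ x) • x) ⬝ᵥ x = 0 := by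
      simp [sub_dotProduct, smul_dotProduct, hx]
    have h0 : (z - (z ⬝ᵥ x) • x) ⬝ᵥ (z - (z ⬝ᵥ x) • x) = 0 := by
      rw [dotProduct_sub, dotProduct_smul, hvx, hzv _ hvx]; simp
    have h1 := sub_eq_zero.1 (dotProduct_self_eq_zero.1 h0)
    rw [← h1, hz]; abel

end SecondOrder

theorem eval_smul_of_isHomogeneous {ι K : Type*} [CommSemiring K] {p : MvPolynomial ι K} {k : ℕ}
    (hp : p.IsHomogeneous k) (c : K) (x : ι → K) : eval (c • x) p = c ^ k * eval x p := by
  rw [eval_eq, eval_eq, Finset.mul_sum]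
  refine Finset.sum_congr rfl fun m hm => ?_
  have hk : ∑ i ∈ m.support, m i = k := by
    rw [← hp (mem_support_iff.1 hm)]
    simp [Finsupp.weight_apply, Finsupp.sum]
  have hprod : ∏ i ∈ m.support, (c • x) i ^ m i = c ^ k * ∏ i ∈ m.support, x i ^ m i := by
    rw [← hk, ← Finset.prod_pow_eq_pow_sum, ← Finset.prod_mul_distrib]
    exact Finset.prod_congr rfl fun i _ => mul_pow _ _ _
  rw [hprod]
  ring

/-! ### Zero sets of homogeneous polynomials are null -/

section NullSet

/-- The zero set of a homogeneous polynomial that does not vanish at some point is null. -/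
theorem volume_zeroSet_of_isHomogeneous {ι : Type*} [Fintype ι] {p : MvPolynomial ι ℝ} {k : ℕ}
    (hp : p.IsHomogeneous k) {b : ι → ℝ} (hb : eval b p ≠ 0) :
    volume {a : ι → ℝ | eval a p = 0} = 0 := by
  have hmeas : MeasurableSet {a : ι → ℝ | eval a p ≠ 0} :=
    (isOpen_ne_fun (MvPolynomial.continuous_eval p) continuous_const).measurableSet
  -- It suffices that every line parallel to `b` meets the zero set in a null set of parameters.
  have hae := ae_mem_of_ae_add_linearMap_mem (LinearMap.toSpanSingleton ℝ (ι → ℝ) b)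
    volume volume hmeas fun y => by
      -- By homogeneity `p (y + t b) = t ^ k * q (t⁻¹)` for `t ≠ 0`, and `q 0 = p b ≠ 0`. The bad
      -- `t` are thus among `0` and the inverses of the roots of `q`.
      let q : Polynomial ℝ :=
        aeval (fun i => Polynomial.C (b i) + Polynomial.X * Polynomial.C (y i)) p
      have hq : ∀ s : ℝ, q.eval s = eval (b + s • y) p := fun s => by
        simp only [q, ← Polynomial.coe_evalRingHom, aeval_def, hom_eval₂]
        rw [eval, ← coe_eval₂Hom]
        congr 2
        · exact RingHom.ext fun r => by simp
        · exact funext fun i => by simpa using mul_comm _ _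
      have hq0 : q ≠ 0 := fun h => hb (by simpa [h] using (hq 0).symm)
      have hfin : ({0} ∪ (fun s : ℝ => s⁻¹) ⁻¹' {s | q.IsRoot s}).Finite :=
        (Set.finite_singleton 0).union
          ((Polynomial.finite_setOfPred_isRoot hq0).preimage inv_injective.injOn)
      refine measure_mono_null (fun t ht => ?_) (hfin.measure_zero volume)
      by_contra hcon
      simp only [Set.mem_union, Set.mem_singleton_iff, Set.mem_preimage, Set.mem_ofPred_eq,
        not_or] at hcon
      obtain ⟨ht0, hroot⟩ := hcon
      apply ht
      have hsm : y + t • b = t • (b + t⁻¹ • y) := by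
        rw [smul_add, smul_smul, mul_inv_cancel₀ ht0, one_smul, add_comm]
      simp only [LinearMap.toSpanSingleton_apply, Set.mem_ofPred_eq]
      rw [hsm, eval_smul_of_isHomogeneous hp]
      exact mul_ne_zero (pow_ne_zero _ ht0) (by rwa [Polynomial.IsRoot, hq] at hroot)
  rw [ae_iff] at hae
  simpa using hae

end NullSet

/-! ### The rank system as an eigenvector problem -/

section RankSystem

variable {n : ℕ}

theorem rank_le_two_iff_exists_mulVec {ι : Type*} [Fintype ι] (A : Matrix ι (Fin 3) ℂ) :
    A.rank ≤ 2 ↔ ∃ v ≠ 0, A.mulVec v = 0 := by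
  have h := LinearMap.finrank_range_add_finrank_ker A.mulVecLin
  rw [Module.finrank_fin_fun] at h
  have h1 : A.rank ≤ 2 ↔ Module.finrank ℂ (LinearMap.ker A.mulVecLin) ≠ 0 := by
    rw [Matrix.rank]; omega
  rw [h1, Ne, Submodule.finrank_eq_zero, ← Ne, Submodule.ne_bot_iff]
  simp [and_comm]

/-- For `x ≠ 0` the rank condition says that `x` is an eigenvector of the gradient and that `y` is a
generalized eigenvector of the Hessian relative to `x`. -/
theorem rank_rankMatrix_le_two_iff (f : MvPolynomial (Fin n) ℂ) {x : Fin n → ℂ} (hx : x ≠ 0)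
    (y : Fin n → ℂ) :
    (rankMatrix f x y).rank ≤ 2 ↔
      ∃ l m : ℂ, grad f x = l • x ∧ (hess f x).mulVec y = l • y + m • x := by
  have hmul : ∀ v : Fin 3 → ℂ, (rankMatrix f x y).mulVec v = 0 ↔
      v 0 • grad f x + v 1 • x = 0 ∧ v 0 • (hess f x).mulVec y + v 1 • y + v 2 • x = 0 := by
    intro v
    simp only [funext_iff, Sum.forall, Matrix.mulVec, dotProduct, Fin.sum_univ_three, rankMatrix,
      Matrix.of_apply, Sum.elim_inl, Sum.elim_inr, Matrix.cons_val, Pi.zero_apply, Pi.add_apply,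
      Pi.smul_apply, smul_eq_mul, zero_mul, add_zero, mul_comm (v _)]
  rw [rank_le_two_iff_exists_mulVec]
  constructor
  · rintro ⟨v, hv, hv'⟩
    obtain ⟨h1, h2⟩ := (hmul v).1 hv'
    -- If `v 0 = 0`, then `x ≠ 0` forces `v 1 = 0` in the first block row and then `v 2 = 0` in the
    -- second.
    have h0 : v 0 ≠ 0 := by
      intro h0
      rw [h0, zero_smul, zero_add] at h1
      have h1' := (smul_eq_zero.1 h1).resolve_right hx
      rw [h0, h1', zero_smul, zero_smul, zero_add, zero_add] at h2
      have h2' := (smul_eq_zero.1 h2).resolve_right hx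
      exact hv (by ext i; fin_cases i <;> assumption)
    refine ⟨-(v 0)⁻¹ * v 1, -(v 0)⁻¹ * v 2, ?_, ?_⟩
    · have := congr((v 0)⁻¹ • $h1)
      rw [smul_add, smul_smul, inv_mul_cancel₀ h0, one_smul, smul_smul, smul_zero] at this
      rw [eq_neg_of_add_eq_zero_left this, neg_mul, neg_smul]
    · have := congr((v 0)⁻¹ • $h2)
      rw [smul_add, smul_add, smul_smul, inv_mul_cancel₀ h0, one_smul, smul_smul, smul_smul,
        smul_zero, add_assoc] at this
      rw [eq_neg_of_add_eq_zero_left this, neg_mul, neg_smul, neg_mul, neg_smul, neg_add]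
  · rintro ⟨l, m, h1, h2⟩
    refine ⟨![1, -l, -m], fun h => one_ne_zero (congr_fun h 0), (hmul _).2 ⟨?_, ?_⟩⟩
    · simp [h1]
    · simp only [h2, Matrix.cons_val]
      simp only [one_smul, neg_smul]; abel

theorem grad_map_ofReal (f : MvPolynomial (Fin n) ℝ) (x : Fin n → ℝ) :
    grad (map (algebraMap ℝ ℂ) f) (fun i => (x i : ℂ)) =
      fun i => ((grad f x i : ℝ) : ℂ) := by
  ext i
  simp only [grad, pderiv_map]
  rw [eval_map]
  exact (eval₂_comp_left (algebraMap ℝ ℂ) (RingHom.id ℝ) x _).symm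

theorem hess_map_ofReal (f : MvPolynomial (Fin n) ℝ) (x : Fin n → ℝ) :
    hess (map (algebraMap ℝ ℂ) f) (fun i => (x i : ℂ)) = (hess f x).map (fun r => (r : ℂ)) := by
  ext i j
  have := congr_fun (grad_map_ofReal (pderiv j f) x) i
  simpa only [hess, grad, pderiv_map, Matrix.of_apply, Matrix.map_apply] using this

/-- A point satisfying the second order necessary but not the second order sufficient condition
gives a solution of the rank system. -/
theorem IsSONCPoint.isSOSCPoint {f : MvPolynomial (Fin n) ℝ} (hf : ¬ RankSystemSolvable f)
    {x : Fin n → ℝ} (h : IsSONCPoint f x) : IsSOSCPoint f x := by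
  by_contra h'
  obtain ⟨l, m, u, hu, hux, hg, hH⟩ := h.exists_of_not_isSOSCPoint h'
  have hx : x ≠ 0 := by
    rintro rfl
    simpa [unitSphere] using h.1
  have hinj : ∀ v : Fin n → ℝ, v ≠ 0 → (fun i => (v i : ℂ)) ≠ 0 := fun v hv h0 =>
    hv (funext fun i => by simpa using congr_fun h0 i)
  refine hf ⟨fun i => x i, fun i => u i, hinj x hx, hinj u hu, ?_, ?_⟩
  · refine (rank_rankMatrix_le_two_iff _ (hinj x hx) _).2 ⟨l, m, ?_, ?_⟩
    · rw [grad_map_ofReal, hg]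
      ext i; simp
    · rw [hess_map_ofReal]
      ext i
      have := congr_fun hH i
      simp only [Matrix.mulVec, dotProduct, Pi.add_apply, Pi.smul_apply, smul_eq_mul] at this
      simp only [Matrix.mulVec, dotProduct, Pi.add_apply, Pi.smul_apply, smul_eq_mul,
        Matrix.map_apply]
      exact_mod_cast this
  · simp only [dotProduct] at hux ⊢
    exact_mod_cast hux

end RankSystem

/-! ### Diagonal forms with unsolvable rank system -/

section Witness

variable {n : ℕ}

/-- The form `∑ a i * x i ^ d`. -/
noncomputable def diagForm {K : Type*} [Field K] (d : ℕ) (a : Fin n → K) : MvPolynomial (Fin n) K :=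
  ∑ i, C (a i) * X i ^ d

theorem diagForm_isHomogeneous {K : Type*} [Field K] (d : ℕ) (a : Fin n → K) :
    (diagForm d a).IsHomogeneous d :=
  IsHomogeneous.sum _ _ _ fun i _ => isHomogeneous_C_mul_X_pow (a i) i d

theorem map_diagForm (d : ℕ) (a : Fin n → ℝ) :
    map (algebraMap ℝ ℂ) (diagForm d a) = diagForm d fun i => (a i : ℂ) := by
  simp [diagForm]

theorem pderiv_diagForm {K : Type*} [Field K] (d : ℕ) (a : Fin n → K) (i : Fin n) :
    pderiv i (diagForm d a) = C (d * a i) * X i ^ (d - 1) := by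
  simp only [diagForm, map_sum, pderiv_C_mul, pderiv_pow, pderiv_X]
  rw [Finset.sum_eq_single i]
  · simp; ring
  · intro j _ hj
    simp [hj]
  · simp

theorem grad_diagForm {K : Type*} [Field K] (d : ℕ) (a x : Fin n → K) (i : Fin n) :
    grad (diagForm d a) x i = d * a i * x i ^ (d - 1) := by
  simp [grad, pderiv_diagForm]

theorem hess_diagForm_mulVec {K : Type*} [Field K] (d : ℕ) (a x y : Fin n → K) (i : Fin n) :
    (hess (diagForm d a) x).mulVec y i = d * a i * (d - 1 : ℕ) * x i ^ (d - 1 - 1) * y i := by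
  simp only [Matrix.mulVec, dotProduct, hess, Matrix.of_apply, pderiv_diagForm]
  rw [Finset.sum_eq_single i]
  · rw [pderiv_C_mul, pderiv_pow, pderiv_X_self]
    simp only [map_mul, eval_C, map_pow, eval_X, map_natCast, mul_one]
    ring
  · intro j _ hj
    simp [hj]
  · simp

/-- A sum of squares of complex numbers whose moduli are, up to a common positive factor, distinct
powers of two is nonzero. -/
theorem sum_sq_ne_zero_of_norm_eq {s : Finset (Fin n)} (hs : s.Nonempty) {x : Fin n → ℂ} {t : ℝ}
    (ht : 0 < t) (h : ∀ i ∈ s, ‖x i‖ = t * 2 ^ (i : ℕ)) : ∑ i ∈ s, x i ^ 2 ≠ 0 := by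
  intro h0
  set k := s.max' hs with hk
  have hks : k ∈ s := s.max'_mem hs
  rw [← Finset.add_sum_erase s _ hks] at h0
  have h1 : ‖x k‖ ^ 2 ≤ ∑ i ∈ s.erase k, ‖x i‖ ^ 2 := by
    rw [← norm_pow, eq_neg_of_add_eq_zero_left h0, norm_neg]
    refine (norm_sum_le _ _).trans (Finset.sum_le_sum fun i _ => (norm_pow _ _).le)
  -- The squared moduli are `t ^ 2 * 4 ^ i`, and the largest exceeds the sum of all smaller ones, so
  -- no cancellation is possible.
  have hgeom : ∀ m : ℕ, ∑ j ∈ Finset.range m, (4 : ℝ) ^ j < 4 ^ m := fun m => by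
    rw [geom_sum_eq (by norm_num)]
    have : (0 : ℝ) < 4 ^ m := by positivity
    rw [div_lt_iff₀ (by norm_num)]
    linarith
  have hval : ∀ i ∈ s, ‖x i‖ ^ 2 = t ^ 2 * 4 ^ (i : ℕ) := fun i hi => by
    rw [h i hi, mul_pow, ← pow_mul, mul_comm (i : ℕ) 2, pow_mul]; norm_num
  rw [hval k hks, Finset.sum_congr rfl fun i hi => hval i (Finset.mem_of_mem_erase hi),
    ← Finset.mul_sum] at h1
  have h2 := le_of_mul_le_mul_left h1 (by positivity)
  have h3 : ∑ i ∈ s.erase k, (4 : ℝ) ^ (i : ℕ) ≤ ∑ j ∈ Finset.range k, (4 : ℝ) ^ j := by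
    rw [← Finset.sum_image (f := fun j : ℕ => (4 : ℝ) ^ j) (g := fun i : Fin n => (i : ℕ))
      (fun i _ j _ hij => Fin.ext hij)]
    refine Finset.sum_le_sum_of_subset_of_nonneg (fun j hj => ?_) fun _ _ _ => by positivity
    obtain ⟨i, hi, rfl⟩ := Finset.mem_image.1 hj
    exact Finset.mem_range.2 (lt_of_le_of_ne (s.le_max' i (Finset.mem_of_mem_erase hi))
      (fun h => Finset.ne_of_mem_erase hi (Fin.ext h)))
  linarith [hgeom k]

/-- For every positive degree some form has an unsolvable rank system. -/
theorem exists_not_rankSystemSolvable (n : ℕ) {d : ℕ} (hd : 1 ≤ d) :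
    ∃ f : MvPolynomial (Fin n) ℝ, f.IsHomogeneous d ∧ ¬ RankSystemSolvable f := by
  -- For `d = 1` any positive `a` would do; for `d = 2` the eigenvalues `2 * a i` have to be
  -- distinct. For `d ≥ 3` the nonzero `x i` have `x i ^ (d - 2)` proportional to `(a i)⁻¹`, so this
  -- choice makes `‖x i‖` proportional to `2 ^ i`.
  set a : Fin n → ℝ := fun i => if d ≤ 2 then (i : ℝ) + 1 else ((2 : ℝ) ^ ((i : ℕ) * (d - 2)))⁻¹
    with ha
  have ha0 : ∀ i, 0 < a i := fun i => by
    simp only [ha]; split_ifs <;> positivity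
  refine ⟨diagForm d a, diagForm_isHomogeneous d a, ?_⟩
  rintro ⟨x, y, hx, hy, hrank, hyx⟩
  rw [map_diagForm, rank_rankMatrix_le_two_iff _ hx] at hrank
  obtain ⟨l, m, hg, hH⟩ := hrank
  have hg' : ∀ i, d * (a i : ℂ) * x i ^ (d - 1) = l * x i := fun i => by
    simpa [grad_diagForm] using congr_fun hg i
  have hH' : ∀ i, d * (a i : ℂ) * (d - 1 : ℕ) * x i ^ (d - 1 - 1) * y i = l * y i + m * x i :=
    fun i => by simpa [hess_diagForm_mulVec] using congr_fun hH i
  have hac : ∀ i, (a i : ℂ) ≠ 0 := fun i => by exact_mod_cast (ha0 i).ne'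
  have hd0 : (d : ℂ) ≠ 0 := by exact_mod_cast (by omega : d ≠ 0)
  obtain ⟨p, hp⟩ := Function.ne_iff.1 hx
  obtain ⟨q, hq⟩ := Function.ne_iff.1 hy
  simp only [Pi.zero_apply] at hp hq
  rcases (by omega : d = 1 ∨ d = 2 ∨ 3 ≤ d) with rfl | rfl | hd3
  -- Degree 1: `a = l x` and `0 = l y + m x`, so `y ⬝ᵥ x = 0` gives `m * ∑ a i ^ 2 = 0`, whence `m =
  -- 0` and `y = 0`.
  · simp only [Nat.cast_one, one_mul, Nat.sub_self, pow_zero, mul_one, Nat.cast_zero, mul_zero,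
      zero_mul] at hg' hH'
    have hl : l ≠ 0 := fun h => hac p (by simpa [h] using hg' p)
    have hy' : ∀ i, l ^ 2 * (y i * x i) = -m * (a i : ℂ) ^ 2 / l := fun i => by
      rw [hg' i]
      field_simp
      linear_combination -(x i) * hH' i
    have h0 : -m / l * ∑ i, (a i : ℂ) ^ 2 = 0 := by
      rw [Finset.mul_sum, Finset.sum_congr rfl fun i _ => (by rw [hy' i]; ring :
        -m / l * (a i : ℂ) ^ 2 = l ^ 2 * (y i * x i)), ← Finset.mul_sum]
      rw [dotProduct] at hyx
      rw [hyx, mul_zero]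
    have hsum : ∑ i, (a i : ℂ) ^ 2 ≠ 0 := by
      have : 0 < ∑ i, a i ^ 2 :=
        Finset.sum_pos (fun i _ => pow_pos (ha0 i) 2) ⟨p, Finset.mem_univ p⟩
      exact_mod_cast this.ne'
    have hm : m = 0 := by
      simpa [hl] using (mul_eq_zero.1 h0).resolve_right hsum
    have := hH' q
    rw [hm, zero_mul, add_zero] at this
    exact mul_ne_zero hl hq this.symm
  -- Degree 2: distinct eigenvalues confine `x` to the coordinate `p`. Orthogonality gives `y p =
  -- 0`, so a nonzero `y q` would make `l` a second time an eigenvalue.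
  · simp only [Nat.cast_ofNat, Nat.reduceSub, pow_one, pow_zero, Nat.cast_one, mul_one] at hg' hH'
    have hinj : ∀ i, 2 * (a i : ℂ) = l → i = p := by
      intro i hi
      have hlp : 2 * (a p : ℂ) = l := mul_right_cancel₀ hp (hg' p)
      have h1 : (a i : ℂ) = a p := by
        have h2 : (2 : ℂ) ≠ 0 := two_ne_zero
        exact mul_left_cancel₀ h2 (hi.trans hlp.symm)
      have h3 : a i = a p := by exact_mod_cast h1
      simp only [ha, le_refl, if_true, add_left_inj] at h3
      exact Fin.ext (by exact_mod_cast h3)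
    have hx0 : ∀ i, i ≠ p → x i = 0 := fun i hi => by
      by_contra h
      exact hi (hinj i (mul_right_cancel₀ h (hg' i)))
    have hqp : q ≠ p := by
      rintro rfl
      rw [dotProduct, Finset.sum_eq_single q (fun i _ hi => by rw [hx0 i hi, mul_zero])
        (by simp)] at hyx
      exact mul_ne_zero hq hp hyx
    have := hH' q
    rw [hx0 q hqp, mul_zero, add_zero] at this
    exact hqp (hinj q (mul_right_cancel₀ hq this))
  -- Degree at least 3: `d * a i * x i ^ (d - 2) = l` on the support of `x` turns the Hessian
  -- equation into `(d - 2) l y = m x`. Then `m ≠ 0` and `∑ x i ^ 2 = 0`, against the prescribed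
  -- moduli.
  · have hl : l ≠ 0 := by
      rintro rfl
      have := hg' p
      simp [hac p, hp, hd0] at this
    have hxl : ∀ i, x i ≠ 0 → d * (a i : ℂ) * x i ^ (d - 1 - 1) = l := fun i hi => by
      refine mul_right_cancel₀ hi ?_
      rw [← hg' i, mul_assoc, ← pow_succ]
      congr 2; omega
    have hd2 : ((d - 1 : ℕ) : ℂ) - 1 ≠ 0 := by
      rw [sub_ne_zero]
      exact_mod_cast (by omega : d - 1 ≠ 1)
    have hyx' : ∀ i, ((d - 1 : ℕ) - 1) * l * y i = m * x i := by
      intro i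
      by_cases hi : x i = 0
      · have := hH' i
        rw [hi, zero_pow (by omega)] at this
        have hyi : y i = 0 := by simpa [hl] using this
        rw [hi, hyi]; simp
      · linear_combination hH' i - (d - 1 : ℕ) * y i * hxl i hi
    have hm : m ≠ 0 := by
      rintro rfl
      have := hyx' q
      rw [zero_mul] at this
      exact mul_ne_zero (mul_ne_zero hd2 hl) hq this
    have hsum : m * ∑ i, x i ^ 2 = 0 := by
      rw [dotProduct] at hyx
      rw [Finset.mul_sum, Finset.sum_congr rfl fun i _ => (by linear_combination -(x i) * hyx' i :
        m * x i ^ 2 = ((d - 1 : ℕ) - 1) * l * (y i * x i)), ← Finset.mul_sum, hyx, mul_zero]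
    have hsum' : ∑ i ∈ Finset.univ.filter (fun i => x i ≠ 0), x i ^ 2 = 0 := by
      rw [Finset.sum_filter_of_ne fun i _ h => by rintro h0; simp [h0] at h]
      exact (mul_eq_zero.1 hsum).resolve_left hm
    have hnorm : ∀ i, x i ≠ 0 → (‖x i‖ / 2 ^ (i : ℕ)) ^ (d - 2) = ‖l‖ / d := by
      intro i hi
      have h := congr(‖$(hxl i hi)‖)
      rw [norm_mul, norm_mul, norm_pow, Complex.norm_natCast, Complex.norm_real,
        Real.norm_of_nonneg (ha0 i).le, Nat.sub_sub] at h
      simp only [ha, if_neg (by omega : ¬ d ≤ 2)] at h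
      rw [← h, div_pow, ← pow_mul]
      have : (d : ℝ) ≠ 0 := by exact_mod_cast (by omega : d ≠ 0)
      field_simp
    refine sum_sq_ne_zero_of_norm_eq (t := ‖x p‖ / 2 ^ (p : ℕ)) ⟨p, by simpa using hp⟩
      (by have := norm_pos_iff.2 hp; positivity) (fun i hi => ?_) hsum'
    have hi' : x i ≠ 0 := by simpa using hi
    have := (pow_left_inj₀ (by positivity) (by positivity) (by omega : d - 2 ≠ 0)).1
      ((hnorm i hi').trans (hnorm p hp).symm)
    rw [← this]
    field_simp

end Witness

/-! ### Elimination for bihomogeneous systems -/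

section Bihomogeneous

variable {n : ℕ}

/-- The weights in `ℕ × ℕ` that record the degrees in the two groups of variables. -/
def bidegree (n : ℕ) : Fin n ⊕ Fin n → ℕ × ℕ := Sum.elim (fun _ => (1, 0)) fun _ => (0, 1)

theorem weight_bidegree (t : Fin n ⊕ Fin n →₀ ℕ) :
    Finsupp.weight (bidegree n) t = (∑ i, t (Sum.inl i), ∑ i, t (Sum.inr i)) := by
  rw [Finsupp.weight_apply, Finsupp.sum_fintype _ _ (by simp), Fintype.sum_sum_type]
  simp only [bidegree, Sum.elim_inl, Sum.elim_inr]
  ext <;> simp [Prod.fst_sum, Prod.snd_sum]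

/-- The exponents of bidegree `(N, N)`. -/
abbrev BiIndex (n N : ℕ) : Type :=
  {t : Fin n ⊕ Fin n →₀ ℕ // Finsupp.weight (bidegree n) t = (N, N)}

instance (n N : ℕ) : Finite (BiIndex n N) := by
  refine Set.Finite.to_subtype ((Set.finite_Iic
    (Finsupp.equivFunOnFinite.symm fun _ : Fin n ⊕ Fin n => N)).subset fun t ht => ?_)
  have h : (∑ i, t (Sum.inl i), ∑ i, t (Sum.inr i)) = (N, N) := by
    rw [← weight_bidegree]; exact ht
  rw [Prod.mk.injEq] at h
  intro s
  simp only [Finsupp.equivFunOnFinite_symm_apply_apply]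
  rcases s with i | i
  · exact (Finset.single_le_sum (f := fun i => t (Sum.inl i)) (fun _ _ => Nat.zero_le _)
      (Finset.mem_univ i)).trans h.1.le
  · exact (Finset.single_le_sum (f := fun i => t (Sum.inr i)) (fun _ _ => Nat.zero_le _)
      (Finset.mem_univ i)).trans h.2.le

noncomputable instance (n N : ℕ) : Fintype (BiIndex n N) := Fintype.ofFinite _

open Classical in
/-- The determinant of the coefficients at the monomials of bidegree `(N, N)` of a family of
multiples of the polynomials `F j` by monomials. -/
noncomputable def minor {R J : Type*} [CommRing R] (F : J → MvPolynomial (Fin n ⊕ Fin n) R) (N : ℕ)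
    (κ : BiIndex n N → (Fin n ⊕ Fin n →₀ ℕ) × J) : R :=
  Matrix.det (Matrix.of fun t c : BiIndex n N =>
    coeff (t : Fin n ⊕ Fin n →₀ ℕ) (monomial (κ c).1 1 * F (κ c).2))

/-- Minors commute with specialization of the coefficients, so minors of the generic system serve
for every particular one. -/
theorem map_minor {R S J : Type*} [CommRing R] [CommRing S] (ψ : R →+* S)
    (F : J → MvPolynomial (Fin n ⊕ Fin n) R) (N : ℕ)
    (κ : BiIndex n N → (Fin n ⊕ Fin n →₀ ℕ) × J) :
    ψ (minor F N κ) = minor (fun j => map ψ (F j)) N κ := by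
  rw [minor, RingHom.map_det, minor]
  congr 1
  ext t c
  simp [← coeff_map]

/-- Evaluation at a solution, restricted to bidegree `(N, N)`, is a linear functional that kills
every bihomogeneous multiple of the equations: either `G` has that bidegree and the sum is its
value, or all the coefficients involved are zero. -/
theorem sum_coeff_mul_eval_monomial {R : Type*} [CommRing R] {G : MvPolynomial (Fin n ⊕ Fin n) R}
    {k : ℕ × ℕ} (hG : IsWeightedHomogeneous (bidegree n) G k) {z : Fin n ⊕ Fin n → R}
    (hz : eval z G = 0) (N : ℕ) :
    ∑ t : BiIndex n N, eval z (monomial (t : Fin n ⊕ Fin n →₀ ℕ) 1) * coeff t.1 G = 0 := by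
  classical
  by_cases hk : k = (N, N)
  · subst hk
    have hG' : G = ∑ t : BiIndex n N, monomial t.1 (coeff t.1 G) := by
      ext m
      simp only [coeff_sum, coeff_monomial]
      by_cases hm : Finsupp.weight (bidegree n) m = (N, N)
      · rw [Finset.sum_eq_single (⟨m, hm⟩ : BiIndex n N)]
        · simp
        · intro t _ ht
          rw [if_neg fun h => ht (Subtype.ext h)]
        · simp
      · rw [hG.coeff_eq_zero m hm, Finset.sum_eq_zero]
        intro t _
        rw [if_neg fun h => hm (by rw [← h]; exact t.2)]
    rw [← hz]
    conv_rhs => rw [hG', map_sum]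
    refine Finset.sum_congr rfl fun t _ => ?_
    rw [eval_monomial, eval_monomial, one_mul, mul_comm]
  · refine Finset.sum_eq_zero fun t _ => ?_
    rw [hG.coeff_eq_zero t.1 fun h => hk (by rw [← h]; exact t.2), mul_zero]

theorem minor_eq_zero_of_solution {K J : Type*} [Field K]
    {F : J → MvPolynomial (Fin n ⊕ Fin n) K}
    (hF : ∀ j, ∃ k, IsWeightedHomogeneous (bidegree n) (F j) k) {x y : Fin n → K} (hx : x ≠ 0)
    (hy : y ≠ 0) (h : ∀ j, eval (Sum.elim x y) (F j) = 0) (N : ℕ)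
    (κ : BiIndex n N → (Fin n ⊕ Fin n →₀ ℕ) × J) : minor F N κ = 0 := by
  classical
  obtain ⟨p, hp⟩ := Function.ne_iff.1 hx
  obtain ⟨q, hq⟩ := Function.ne_iff.1 hy
  rw [minor]
  convert Matrix.exists_vecMul_eq_zero_iff.1 ⟨fun t : BiIndex n N =>
    eval (Sum.elim x y) (monomial (t : Fin n ⊕ Fin n →₀ ℕ) 1), ?_, ?_⟩
  -- The monomial `x p ^ N * y q ^ N` keeps the left kernel vector from being zero.
  · have ht : Finsupp.weight (bidegree n)
        (Finsupp.single (Sum.inl p) N + Finsupp.single (Sum.inr q) N) = (N, N) := by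
      simp [Finsupp.weight_single, bidegree]
    intro h0
    have := congr_fun h0 ⟨_, ht⟩
    rw [← one_mul (1 : K), ← monomial_mul, map_mul] at this
    simp [eval_monomial] at this
    simp_all
  · ext c
    obtain ⟨k, hk⟩ := hF (κ c).2
    exact sum_coeff_mul_eval_monomial ((isWeightedHomogeneous_monomial _ (κ c).1 (1 : K) rfl).mul hk)
      (by rw [map_mul, h, mul_zero]) N

/-- A spanning family of vectors contains the columns of an invertible matrix. -/
theorem exists_det_ne_zero_of_span_eq_top {K ι α : Type*} [Field K] [Fintype ι] [DecidableEq ι]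
    (v : α → ι → K) (hv : Submodule.span K (Set.range v) = ⊤) :
    ∃ κ : ι → α, (Matrix.of fun t c => v (κ c) t).det ≠ 0 := by
  obtain ⟨b, hb, hspan, hli⟩ := exists_linearIndependent K (Set.range v)
  rw [hv] at hspan
  let B := Module.Basis.mk hli (by simp [hspan])
  let e := (Pi.basisFun K ι).indexEquiv B
  choose κ hκ using fun c : ι => hb (e c).2
  refine ⟨κ, ?_⟩
  have hli' : LinearIndependent K (Matrix.of fun t c => v (κ c) t).col := by
    have : (Matrix.of fun t c => v (κ c) t).col = fun c => ((e c : b) : ι → K) := by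
      ext c t
      simp [hκ]
    rw [this]
    exact hli.comp e e.injective
  exact ((Matrix.isUnit_iff_isUnit_det _).1
    (Matrix.linearIndependent_cols_iff_isUnit.1 hli')).ne_zero

/-- Each product `x i * y k` vanishes on the zero locus, so a power of it lies in the ideal of the
`F j`. For large `N` every monomial of bidegree `(N, N)` is divisible by such a power, so the
monomial multiples of the `F j` span that bidegree. -/
theorem exists_minor_ne_zero_of_no_solution {K J : Type*} [Field K] [IsAlgClosed K] [Fintype J]
    (F : J → MvPolynomial (Fin n ⊕ Fin n) K)
    (h : ¬ ∃ x y : Fin n → K, x ≠ 0 ∧ y ≠ 0 ∧ ∀ j, eval (Sum.elim x y) (F j) = 0) :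
    ∃ N κ, minor F N κ ≠ 0 := by
  classical
  set I := Ideal.span (Set.range F) with hI
  have hrad : ∀ i k : Fin n, (X (Sum.inl i) * X (Sum.inr k) : MvPolynomial (Fin n ⊕ Fin n) K) ∈
      I.radical := by
    intro i k
    rw [← vanishingIdeal_zeroLocus_eq_radical (K := K), mem_vanishingIdeal_iff]
    intro z hz
    by_contra hne
    simp only [map_mul, aeval_X] at hne
    refine h ⟨z ∘ Sum.inl, z ∘ Sum.inr, fun h0 => left_ne_zero_of_mul hne (congr_fun h0 i),
      fun h0 => right_ne_zero_of_mul hne (congr_fun h0 k), fun j => ?_⟩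
    rw [Sum.elim_comp_inl_inr]
    exact hz _ (Ideal.subset_span ⟨j, rfl⟩)
  choose e he using hrad
  obtain ⟨M, hM⟩ : ∃ M, ∀ i k, e i k ≤ M :=
    ⟨∑ i, ∑ k, e i k, fun i k =>
      (Finset.single_le_sum (f := fun k => e i k) (fun _ _ => Nat.zero_le _)
        (Finset.mem_univ k)).trans (Finset.single_le_sum (f := fun i => ∑ k, e i k)
          (fun _ _ => Nat.zero_le _) (Finset.mem_univ i))⟩
  -- The summand `1` makes this hold for `n = 0` as well, where no index exists.
  have hpigeon : ∀ u : Fin n → ℕ, ∑ i, u i = n * M + 1 → ∃ i, M ≤ u i := by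
    intro u hu
    by_contra hcon
    push Not at hcon
    have : ∑ i, u i ≤ _ := Finset.sum_le_card_nsmul Finset.univ u M fun i _ => (hcon i).le
    simp only [hu, Finset.card_univ, Fintype.card_fin, smul_eq_mul] at this
    omega
  refine ⟨n * M + 1, ?_⟩
  have hmem : ∀ t : BiIndex n (n * M + 1), monomial t.1 (1 : K) ∈ I := by
    rintro ⟨t, ht⟩
    rw [weight_bidegree, Prod.mk.injEq] at ht
    obtain ⟨i, hi⟩ := hpigeon _ ht.1
    obtain ⟨k, hk⟩ := hpigeon _ ht.2
    refine I.mem_of_dvd ?_ (I.pow_mem_of_pow_mem (he i k) (hM i k))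
    have : (X (Sum.inl i) * X (Sum.inr k) : MvPolynomial (Fin n ⊕ Fin n) K) ^ M =
        monomial (Finsupp.single (Sum.inl i) M + Finsupp.single (Sum.inr k) M) 1 := by
      rw [mul_pow, X_pow_eq_monomial, X_pow_eq_monomial, monomial_mul, one_mul]
    rw [this, monomial_dvd_monomial]
    refine ⟨Or.inr fun s => ?_, dvd_rfl⟩
    rcases s with s | s
    · by_cases hs : s = i
      · subst hs; simpa using hi
      · simp [Ne.symm hs]
    · by_cases hs : s = k
      · subst hs; simpa using hk
      · simp [Ne.symm hs]
  let L : MvPolynomial (Fin n ⊕ Fin n) K →ₗ[K] (BiIndex n (n * M + 1) → K) :=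
    LinearMap.pi fun t => lcoeff K t.1
  let v : (Fin n ⊕ Fin n →₀ ℕ) × J → BiIndex n (n * M + 1) → K := fun c =>
    L (monomial c.1 1 * F c.2)
  have hL : ∀ G ∈ I, L G ∈ Submodule.span K (Set.range v) := by
    intro G hG
    obtain ⟨c, rfl⟩ := Ideal.mem_span_range_iff_exists_fun.1 hG
    rw [map_sum]
    refine Submodule.sum_mem _ fun j _ => ?_
    induction c j using MvPolynomial.induction_on' with
    | monomial m a =>
      have : monomial m a = a • monomial m (1 : K) := by simp [smul_monomial]
      rw [this, smul_mul_assoc, map_smul]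
      exact Submodule.smul_mem _ _ (Submodule.subset_span ⟨(m, j), rfl⟩)
    | add p q hp hq =>
      rw [add_mul, map_add]
      exact Submodule.add_mem _ hp hq
  have hspan : Submodule.span K (Set.range v) = ⊤ := by
    rw [eq_top_iff, ← (Pi.basisFun K (BiIndex n (n * M + 1))).span_eq, Submodule.span_le]
    rintro _ ⟨t, rfl⟩
    have : (Pi.basisFun K _) t = L (monomial t.1 1) := by
      ext s
      simp [L, coeff_monomial, Pi.single_apply, Subtype.ext_iff, eq_comm]
    rw [SetLike.mem_coe, this]
    exact hL _ (hmem t)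
  obtain ⟨κ, hκ⟩ := exists_det_ne_zero_of_span_eq_top v hspan
  refine ⟨κ, ?_⟩
  rw [minor]
  convert hκ
  rfl

/-- Elimination theory for `ℙ × ℙ`: the parameters for which a system of bihomogeneous equations has
a solution with both components nonzero form a closed set. -/
theorem exists_eliminant {R J : Type*} [CommRing R] [Fintype J]
    (F : J → MvPolynomial (Fin n ⊕ Fin n) R)
    (hF : ∀ j, ∃ k, IsWeightedHomogeneous (bidegree n) (F j) k) (K : Type*) [Field K]
    [IsAlgClosed K] :
    ∃ S : Set R, ∀ ψ : R →+* K,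
      (∃ x y : Fin n → K, x ≠ 0 ∧ y ≠ 0 ∧ ∀ j, eval (Sum.elim x y) (map ψ (F j)) = 0) ↔
        ∀ p ∈ S, ψ p = 0 := by
  -- No bound on `N` uniform in `ψ` is at hand, so all minors are taken; finiteness is recovered
  -- later by noetherianity.
  refine ⟨{p | ∃ N κ, p = minor F N κ}, fun ψ => ⟨?_, fun h => ?_⟩⟩
  · rintro ⟨x, y, hx, hy, h⟩ _ ⟨N, κ, rfl⟩
    rw [map_minor]
    refine minor_eq_zero_of_solution (fun j => ?_) hx hy h N κ
    obtain ⟨k, hk⟩ := hF j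
    refine ⟨k, fun m hm => hk fun h0 => hm ?_⟩
    rw [coeff_map, h0, map_zero]
  · by_contra hcon
    obtain ⟨N, κ, hκ⟩ := exists_minor_ne_zero_of_no_solution _ hcon
    exact hκ (by rw [← map_minor]; exact h _ ⟨N, κ, rfl⟩)

end Bihomogeneous

/-! ### The rank system as bihomogeneous equations -/

section RankEquations

variable {n : ℕ}

/-- The `j`-th entry of the Hessian of `p` applied to the second group of variables. -/
noncomputable def hessPoly {R : Type*} [CommRing R] (p : MvPolynomial (Fin n) R) (j : Fin n) :
    MvPolynomial (Fin n ⊕ Fin n) R :=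
  ∑ k, rename Sum.inl (pderiv j (pderiv k p)) * X (Sum.inr k)

/-- Indices of the equations equivalent to the rank system. -/
abbrev EqIndex (n : ℕ) : Type := (Fin n × Fin n) ⊕ (Fin n × Fin n × Fin n) ⊕ Unit

/-- Bihomogeneous equations that are equivalent to the rank system for `x ≠ 0`. -/
noncomputable def rankEq {R : Type*} [CommRing R] (p : MvPolynomial (Fin n) R) :
    EqIndex n → MvPolynomial (Fin n ⊕ Fin n) R
  | .inl (i, j) => rename Sum.inl (pderiv i p) * X (Sum.inl j) -
      rename Sum.inl (pderiv j p) * X (Sum.inl i)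
  -- Multiplying `∇²f(x)y - l y` by `x i` and using `∇f(x) i = l * x i` eliminates `l`; the result
  -- must be parallel to `x`.
  | .inr (.inl (i, j, k)) =>
      (X (Sum.inl i) * hessPoly p j - rename Sum.inl (pderiv i p) * X (Sum.inr j)) * X (Sum.inl k) -
      (X (Sum.inl i) * hessPoly p k - rename Sum.inl (pderiv i p) * X (Sum.inr k)) * X (Sum.inl j)
  | .inr (.inr _) => ∑ i, X (Sum.inr i) * X (Sum.inl i)

theorem map_rankEq {R S : Type*} [CommRing R] [CommRing S] (ψ : R →+* S)
    (p : MvPolynomial (Fin n) R) (e : EqIndex n) :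
    map ψ (rankEq p e) = rankEq (map ψ p) e := by
  rcases e with ⟨i, j⟩ | ⟨i, j, k⟩ | _ <;>
  simp [rankEq, hessPoly, map_rename, pderiv_map]

theorem isWeightedHomogeneous_rename_inl {R : Type*} [CommRing R] {p : MvPolynomial (Fin n) R}
    {k : ℕ} (hp : p.IsHomogeneous k) :
    IsWeightedHomogeneous (bidegree n) (rename Sum.inl p) (k, 0) := by
  rw [p.as_sum, map_sum]
  refine IsWeightedHomogeneous.sum _ _ _ fun m hm => ?_
  rw [rename_monomial]
  refine isWeightedHomogeneous_monomial _ _ _ ?_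
  rw [weight_bidegree]
  have h1 := hp (mem_support_iff.1 hm)
  rw [Finsupp.weight_apply, Finsupp.sum_fintype _ _ (by simp)] at h1
  refine Prod.ext ?_ ?_
  · simpa [Finsupp.mapDomain_apply Sum.inl_injective] using h1
  · show ∑ i : Fin n, Finsupp.mapDomain Sum.inl m (Sum.inr i) = 0
    exact Finset.sum_eq_zero fun i _ => Finsupp.mapDomain_of_notMem_range m _ (by simp)

theorem isWeightedHomogeneous_inl {R : Type*} [CommRing R] (i : Fin n) :
    IsWeightedHomogeneous (bidegree n) (X (Sum.inl i) : MvPolynomial (Fin n ⊕ Fin n) R) (1, 0) :=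
  isWeightedHomogeneous_X R (bidegree n) (Sum.inl i)

theorem isWeightedHomogeneous_inr {R : Type*} [CommRing R] (i : Fin n) :
    IsWeightedHomogeneous (bidegree n) (X (Sum.inr i) : MvPolynomial (Fin n ⊕ Fin n) R) (0, 1) :=
  isWeightedHomogeneous_X R (bidegree n) (Sum.inr i)

theorem isWeightedHomogeneous_rankEq {R : Type*} [CommRing R] {p : MvPolynomial (Fin n) R}
    {d : ℕ} (hd : 1 ≤ d) (hp : p.IsHomogeneous d) (e : EqIndex n) :
    ∃ k, IsWeightedHomogeneous (bidegree n) (rankEq p e) k := by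
  have hg : ∀ i, IsWeightedHomogeneous (bidegree n) (rename Sum.inl (pderiv i p)) (d - 1, 0) :=
    fun i => isWeightedHomogeneous_rename_inl hp.pderiv
  have hH : ∀ i j, IsWeightedHomogeneous (bidegree n)
      (X (Sum.inl i) * hessPoly p j) (d - 1, 1) := by
    intro i j
    -- For `d = 1` the truncated `d - 1 - 1` would give the wrong degree, but the Hessian is zero
    -- and thus homogeneous of any bidegree.
    rcases hd.eq_or_lt with rfl | hd2
    · have h0 : ∀ k, pderiv j (pderiv k p) = 0 := by
        intro k
        have hdeg := (totalDegree_zero_iff_isHomogeneous (p := pderiv k p)).2 hp.pderiv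
        rw [totalDegree_eq_zero_iff_eq_C.1 hdeg, pderiv_C]
      simp only [hessPoly, h0, map_zero, zero_mul, Finset.sum_const_zero, mul_zero]
      exact isWeightedHomogeneous_zero _ _ _
    · have : ((d - 1, 1) : ℕ × ℕ) = (1, 0) + ((d - 1 - 1, 0) + (0, 1)) := by
        ext
        · simp; omega
        · simp
      rw [this]
      exact (isWeightedHomogeneous_inl i).mul (IsWeightedHomogeneous.sum _ _ _ fun k _ =>
        (isWeightedHomogeneous_rename_inl hp.pderiv.pderiv).mul (isWeightedHomogeneous_inr k))
  rcases e with ⟨i, j⟩ | ⟨i, j, k⟩ | _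
  · exact ⟨_, ((hg i).mul (isWeightedHomogeneous_inl j)).sub
      ((hg j).mul (isWeightedHomogeneous_inl i))⟩
  · have hB : ∀ j k, IsWeightedHomogeneous (bidegree n) ((X (Sum.inl i) * hessPoly p j -
        rename Sum.inl (pderiv i p) * X (Sum.inr j)) * X (Sum.inl k)) ((d - 1, 1) + (1, 0)) := by
      intro j k
      refine IsWeightedHomogeneous.mul ((hH i j).sub ?_) (isWeightedHomogeneous_inl k)
      simpa using (hg i).mul (isWeightedHomogeneous_inr j)
    exact ⟨_, (hB j k).sub (hB k j)⟩
  · exact ⟨_, IsWeightedHomogeneous.sum _ _ _ fun i _ =>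
      (isWeightedHomogeneous_inr i).mul (isWeightedHomogeneous_inl i)⟩

/-- A vector all of whose `2 × 2` minors with a nonzero vector vanish is a multiple of it. -/
theorem exists_eq_smul_iff {K : Type*} [Field K] {x : Fin n → K} (hx : x ≠ 0) (v : Fin n → K) :
    (∃ c : K, v = c • x) ↔ ∀ i j, v i * x j - v j * x i = 0 := by
  constructor
  · rintro ⟨c, rfl⟩ i j
    simp only [Pi.smul_apply, smul_eq_mul]; ring
  · intro h
    obtain ⟨k, hk⟩ := Function.ne_iff.1 hx
    refine ⟨v k / x k, funext fun i => ?_⟩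
    have hk' : x k ≠ 0 := hk
    simp only [Pi.smul_apply, smul_eq_mul]
    field_simp
    linear_combination h i k

theorem eval_rankEq_iff (f : MvPolynomial (Fin n) ℂ) {x : Fin n → ℂ} (hx : x ≠ 0)
    (y : Fin n → ℂ) :
    (∀ e, eval (Sum.elim x y) (rankEq f e) = 0) ↔
      (rankMatrix f x y).rank ≤ 2 ∧ y ⬝ᵥ x = 0 := by
  have hren : ∀ p : MvPolynomial (Fin n) ℂ,
      eval (Sum.elim x y) (rename Sum.inl p) = eval x p := fun p => by
    rw [eval_rename, Sum.elim_comp_inl]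
  have hhess : ∀ j, eval (Sum.elim x y) (hessPoly f j) = (hess f x).mulVec y j := fun j => by
    simp [hessPoly, hren, Matrix.mulVec, dotProduct, hess]
  have hgrad : ∀ i, eval x (pderiv i f) = grad f x i := fun i => rfl
  rw [rank_rankMatrix_le_two_iff f hx, Sum.forall, Sum.forall]
  simp only [Prod.forall, rankEq, map_sub, map_mul, map_sum, hren, hhess, eval_X, Sum.elim_inl,
    Sum.elim_inr, hgrad, forall_const]
  rw [← exists_eq_smul_iff hx, ← and_assoc]
  refine and_congr ?_ Iff.rfl
  have hB : ∀ i, (∀ j k, (x i * (hess f x).mulVec y j - grad f x i * y j) * x k -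
      (x i * (hess f x).mulVec y k - grad f x i * y k) * x j = 0) ↔
      ∃ c : ℂ, x i • (hess f x).mulVec y - grad f x i • y = c • x := fun i => by
    rw [exists_eq_smul_iff hx]; rfl
  simp only [hB]
  constructor
  · rintro ⟨⟨l, hl⟩, h⟩
    obtain ⟨k, hk⟩ := Function.ne_iff.1 hx
    have hk' : x k ≠ 0 := hk
    obtain ⟨c, hc⟩ := h k
    -- The equations with first index `k` read `x k • (∇²f(x)y - l y) = c x`; division by `x k ≠ 0`
    -- gives the second multiplier.
    refine ⟨l, c / x k, hl, funext fun i => ?_⟩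
    have := congr_fun hc i
    rw [hl] at this
    simp only [Pi.sub_apply, Pi.smul_apply, smul_eq_mul, Pi.add_apply] at this ⊢
    field_simp
    linear_combination this
  · rintro ⟨l, m, hl, hm⟩
    refine ⟨⟨l, hl⟩, fun i => ⟨x i * m, ?_⟩⟩
    rw [hl, hm]
    ext j
    simp only [Pi.sub_apply, Pi.smul_apply, smul_eq_mul, Pi.add_apply]
    ring

theorem rankSystemSolvable_iff (f : MvPolynomial (Fin n) ℝ) :
    RankSystemSolvable f ↔ ∃ x y : Fin n → ℂ, x ≠ 0 ∧ y ≠ 0 ∧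
      ∀ e, eval (Sum.elim x y) (rankEq (map (algebraMap ℝ ℂ) f) e) = 0 := by
  refine exists_congr fun x => exists_congr fun y => ?_
  constructor
  · rintro ⟨hx, hy, h⟩
    exact ⟨hx, hy, (eval_rankEq_iff _ hx y).2 h⟩
  · rintro ⟨hx, hy, h⟩
    exact ⟨hx, hy, (eval_rankEq_iff _ hx y).1 h⟩

/-- The same `x, y` work with both multipliers scaled by `c`. This cone property permits homogeneous
elimination polynomials. -/
theorem RankSystemSolvable.smul {f : MvPolynomial (Fin n) ℝ} (h : RankSystemSolvable f) (c : ℝ) :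
    RankSystemSolvable (c • f) := by
  obtain ⟨x, y, hx, hy, hr, hyx⟩ := h
  obtain ⟨l, m, hg, hH⟩ := (rank_rankMatrix_le_two_iff _ hx y).1 hr
  refine ⟨x, y, hx, hy, (rank_rankMatrix_le_two_iff _ hx y).2
    ⟨(c : ℂ) * l, (c : ℂ) * m, ?_, ?_⟩, hyx⟩
  · rw [mul_smul, ← hg]
    ext i
    simp [grad, smul_eq_C_mul]
  · rw [mul_smul, mul_smul, ← smul_add, ← hH]
    ext i
    simp [hess, smul_eq_C_mul, Matrix.mulVec, dotProduct, Finset.mul_sum, mul_assoc]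

end RankEquations

/-! ### Forms, their coefficient vectors and the generic form -/

section Forms

variable {n d : ℕ}

theorem mem_formIndex {m : Fin n →₀ ℕ} :
    m ∈ Finset.finsuppAntidiag (Finset.univ : Finset (Fin n)) d ↔ ∑ i, m i = d := by
  simp [Finset.mem_finsuppAntidiag]

theorem isHomogeneous_sum_monomial {R : Type*} [CommRing R] (a : FormIndex n d → R) :
    (∑ m : FormIndex n d, monomial (m : Fin n →₀ ℕ) (a m)).IsHomogeneous d := by
  refine IsHomogeneous.sum _ _ _ fun m _ => isHomogeneous_monomial _ ?_
  rw [Finsupp.degree_eq_sum]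
  exact mem_formIndex.1 m.2

theorem formOf_isHomogeneous (a : FormIndex n d → ℝ) : (formOf a).IsHomogeneous d :=
  isHomogeneous_sum_monomial a

theorem coeffVec_formOf (a : FormIndex n d → ℝ) : coeffVec d (formOf a) = a := by
  ext m
  simp only [coeffVec, formOf, coeff_sum, coeff_monomial]
  rw [Finset.sum_eq_single m]
  · simp
  · intro k _ hk
    rw [if_neg fun h => hk (Subtype.ext h)]
  · simp

theorem formOf_coeffVec {f : MvPolynomial (Fin n) ℝ} (hf : f.IsHomogeneous d) :
    formOf (coeffVec d f) = f := by
  ext m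
  by_cases hm : ∑ i, m i = d
  · exact congr_fun (coeffVec_formOf (coeffVec d f)) ⟨m, mem_formIndex.2 hm⟩
  · rw [← Finsupp.degree_eq_sum] at hm
    rw [hf.coeff_eq_zero hm, (formOf_isHomogeneous _).coeff_eq_zero hm]

theorem formOf_smul (c : ℝ) (a : FormIndex n d → ℝ) : formOf (c • a) = c • formOf a := by
  simp [formOf, Finset.smul_sum, smul_monomial]

/-- The form of degree `d` with indeterminate coefficients. -/
noncomputable def genericForm (n d : ℕ) :
    MvPolynomial (Fin n) (MvPolynomial (FormIndex n d) ℤ) :=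
  ∑ m : FormIndex n d, monomial (m : Fin n →₀ ℕ) (X m)

theorem map_genericForm (a : FormIndex n d → ℝ) :
    map ((algebraMap ℝ ℂ).comp (aeval a : MvPolynomial (FormIndex n d) ℤ →ₐ[ℤ] ℝ).toRingHom)
      (genericForm n d) = map (algebraMap ℝ ℂ) (formOf a) := by
  simp [genericForm, formOf]

theorem exists_eliminant_rankSystem (n : ℕ) {d : ℕ} (hd : 1 ≤ d) :
    ∃ S : Set (MvPolynomial (FormIndex n d) ℤ), ∀ a : FormIndex n d → ℝ,
      RankSystemSolvable (formOf a) ↔ ∀ p ∈ S, aeval a p = 0 := by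
  obtain ⟨S, hS⟩ := exists_eliminant (rankEq (genericForm n d))
    (isWeightedHomogeneous_rankEq hd (isHomogeneous_sum_monomial _)) ℂ
  refine ⟨S, fun a => ?_⟩
  rw [rankSystemSolvable_iff, ← map_genericForm]
  have := hS ((algebraMap ℝ ℂ).comp
    (aeval a : MvPolynomial (FormIndex n d) ℤ →ₐ[ℤ] ℝ).toRingHom)
  simp only [map_rankEq] at this
  rw [this]
  simp

end Forms

/-! ### Passing to finitely many homogeneous polynomials -/

section Homogenization

variable {ι : Type*}

theorem aeval_smul_of_isHomogeneous {p : MvPolynomial ι ℤ} {k : ℕ} (hp : p.IsHomogeneous k)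
    (c : ℝ) (a : ι → ℝ) : aeval (c • a) p = c ^ k * aeval a p := by
  have h : ∀ b : ι → ℝ, aeval b p = eval b (map (algebraMap ℤ ℝ) p) := fun b => by
    rw [eval_map, aeval_def]
  rw [h, h, eval_smul_of_isHomogeneous (hp.map _)]

/-- The values of the components at `a` are the coefficients of the polynomial function `c ↦ p (c
a)`, which is zero on all of `ℝ`. -/
theorem aeval_homogeneousComponent_eq_zero {p : MvPolynomial ι ℤ} {a : ι → ℝ}
    (h : ∀ c : ℝ, aeval (c • a) p = 0) (k : ℕ) : aeval a (homogeneousComponent k p) = 0 := by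
  by_cases hk : p.totalDegree < k
  · rw [homogeneousComponent_eq_zero _ _ hk, map_zero]
  let q : Polynomial ℝ := ∑ j ∈ Finset.range (p.totalDegree + 1),
    Polynomial.monomial j (aeval a (homogeneousComponent j p))
  have hq : q = 0 := by
    refine Polynomial.funext fun c => ?_
    rw [Polynomial.eval_zero, ← h c]
    conv_rhs => rw [← sum_homogeneousComponent p, map_sum]
    rw [Polynomial.eval_finsetSum]
    refine Finset.sum_congr rfl fun j _ => ?_
    rw [aeval_smul_of_isHomogeneous (homogeneousComponent_isHomogeneous j p),
      Polynomial.eval_monomial, mul_comm]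
  have := congr(Polynomial.coeff $hq k)
  simp only [q, Polynomial.finsetSum_coeff, Polynomial.coeff_monomial, Polynomial.coeff_zero] at this
  rw [Finset.sum_ite_eq', if_pos (Finset.mem_range.2 (by omega))] at this
  exact this

/-- A cone cut out by integer polynomials is cut out by finitely many homogeneous ones. -/
theorem exists_finite_homogeneous [Finite ι] {S : Set (MvPolynomial ι ℤ)}
    (hS : ∀ a : ι → ℝ, (∀ p ∈ S, aeval a p = 0) → ∀ c : ℝ, ∀ p ∈ S, aeval (c • a) p = 0) :
    ∃ (s : ℕ) (g : Fin s → MvPolynomial ι ℤ), (∀ i, ∃ k, (g i).IsHomogeneous k) ∧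
      ∀ a : ι → ℝ, (∀ p ∈ S, aeval a p = 0) ↔ ∀ i, aeval a (g i) = 0 := by
  let S' : Set (MvPolynomial ι ℤ) := {q | ∃ p ∈ S, ∃ k, q = homogeneousComponent k p}
  -- Hilbert's basis theorem: finitely many of the components themselves generate the ideal.
  obtain ⟨t, htS, ht⟩ := (Submodule.fg_span_iff_fg_span_finset_subset (R := MvPolynomial ι ℤ) S').1
    (IsNoetherian.noetherian _)
  refine ⟨t.card, fun i => t.equivFin.symm i, fun i => ?_, fun a => ?_⟩
  · obtain ⟨p, _, k, hk⟩ := htS (t.equivFin.symm i).2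
    exact ⟨k, by simp only [hk]; exact homogeneousComponent_isHomogeneous k p⟩
  · constructor
    · intro h i
      obtain ⟨p, hp, k, hk⟩ := htS (t.equivFin.symm i).2
      simp only [hk]
      exact aeval_homogeneousComponent_eq_zero (fun c => hS a h c p hp) k
    · intro h
      have hker : Ideal.span S' ≤ RingHom.ker (aeval a : MvPolynomial ι ℤ →ₐ[ℤ] ℝ) := by
        rw [Ideal.span, ht, ← Ideal.span, Ideal.span_le]
        intro q hq
        simpa using h (t.equivFin ⟨q, hq⟩)
      intro p hp
      rw [← sum_homogeneousComponent p, map_sum]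
      exact Finset.sum_eq_zero fun k _ => hker (Ideal.subset_span ⟨p, hp, k, rfl⟩)

end Homogenization

/-! ### Assembly of the theorem -/

theorem exists_isEliminationFamily (n : ℕ) {d : ℕ} (hd : 1 ≤ d) :
    ∃ (s : ℕ) (g : Fin s → MvPolynomial (FormIndex n d) ℤ), IsEliminationFamily g := by
  obtain ⟨S, hS⟩ := exists_eliminant_rankSystem n hd
  obtain ⟨s, g, hg, h⟩ := exists_finite_homogeneous (S := S) fun a ha c => by
    rw [← hS] at ha ⊢
    rw [formOf_smul]
    exact ha.smul c
  refine ⟨s, g, hg, fun f hf => ?_⟩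
  rw [← h, ← hS, formOf_coeffVec hf]

theorem aeval_sumSquares_eq_zero_iff {n d s : ℕ} (g : Fin s → MvPolynomial (FormIndex n d) ℤ)
    (a : FormIndex n d → ℝ) : aeval a (sumSquares g) = 0 ↔ ∀ i, aeval a (g i) = 0 := by
  simp only [sumSquares, map_sum, map_pow]
  rw [Finset.sum_eq_zero_iff_of_nonneg fun i _ => sq_nonneg _]
  simp

theorem IsEliminationFamily.exists_aeval_ne_zero {n d s : ℕ} (hd : 1 ≤ d)
    {g : Fin s → MvPolynomial (FormIndex n d) ℤ} (hg : IsEliminationFamily g) :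
    ∃ (i : Fin s) (b : FormIndex n d → ℝ), aeval b (g i) ≠ 0 := by
  obtain ⟨f, hf, hns⟩ := exists_not_rankSystemSolvable n hd
  rw [hg.2 f hf] at hns
  push Not at hns
  obtain ⟨i, hi⟩ := hns
  exact ⟨i, _, hi⟩

theorem IsEliminationFamily.sumSquares_ne_zero {n d s : ℕ} (hd : 1 ≤ d)
    {g : Fin s → MvPolynomial (FormIndex n d) ℤ} (hg : IsEliminationFamily g) :
    sumSquares g ≠ 0 := by
  obtain ⟨i, b, hb⟩ := hg.exists_aeval_ne_zero hd
  intro h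
  exact hb ((aeval_sumSquares_eq_zero_iff g b).1 (by rw [h, map_zero]) i)

theorem IsEliminationFamily.volume_zeroSet {n d s : ℕ} (hd : 1 ≤ d)
    {g : Fin s → MvPolynomial (FormIndex n d) ℤ} (hg : IsEliminationFamily g) :
    volume {a : FormIndex n d → ℝ | aeval a (sumSquares g) = 0} = 0 := by
  -- The sum of squares need not be homogeneous, as the `g i` may differ in degree; its zero set
  -- lies in that of a single `g i` that is nonzero somewhere.
  obtain ⟨i, b, hb⟩ := hg.exists_aeval_ne_zero hd
  obtain ⟨k, hk⟩ := hg.1 i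
  have h : ∀ a : FormIndex n d → ℝ, aeval a (g i) = eval a (map (algebraMap ℤ ℝ) (g i)) :=
    fun a => by rw [eval_map, aeval_def]
  refine measure_mono_null (fun a ha => ?_)
    (volume_zeroSet_of_isHomogeneous (hk.map (algebraMap ℤ ℝ)) (b := b) (by rwa [← h]))
  have := (aeval_sumSquares_eq_zero_iff g a).1 ha i
  rw [h] at this
  exact this

theorem IsEliminationFamily.isSOSCPoint_and_isLocalMinimizer {n d s : ℕ}
    {g : Fin s → MvPolynomial (FormIndex n d) ℤ} (hg : IsEliminationFamily g)
    {f : MvPolynomial (Fin n) ℝ} (hf : f.IsHomogeneous d)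
    (hne : aeval (coeffVec d f) (sumSquares g) ≠ 0) {x : Fin n → ℝ} (hx : IsSONCPoint f x) :
    IsSOSCPoint f x ∧ IsLocalMinimizer f x := by
  have hns : ¬ RankSystemSolvable f := fun h =>
    hne ((aeval_sumSquares_eq_zero_iff g _).2 ((hg.2 f hf).1 h))
  have := hx.isSOSCPoint hns
  exact ⟨this, this.isLocalMinimizer⟩

end SphereOpt

/-- Elimination polynomials exist. For every choice of them, with sum of squares `φ`: `φ` does not
vanish identically, its real zero set is Lebesgue-null, and `φ(f) ≠ 0` implies that every SONC point
of `f` is an SOSC point and a local minimizer. Consequently this holds for almost every `f`. -/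
theorem theorem3p4 (n d : ℕ) (hd : 1 ≤ d) :
    (∃ (s : ℕ) (g : Fin s → MvPolynomial (SphereOpt.FormIndex n d) ℤ),
      SphereOpt.IsEliminationFamily g) ∧
    (∀ (s : ℕ) (g : Fin s → MvPolynomial (SphereOpt.FormIndex n d) ℤ),
      SphereOpt.IsEliminationFamily g →
        SphereOpt.sumSquares g ≠ 0 ∧
        volume {a : SphereOpt.FormIndex n d → ℝ |
          aeval a (SphereOpt.sumSquares g) = 0} = 0 ∧
        ∀ f : MvPolynomial (Fin n) ℝ, f.IsHomogeneous d →
          aeval (SphereOpt.coeffVec d f) (SphereOpt.sumSquares g) ≠ 0 →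
            ∀ x : Fin n → ℝ, SphereOpt.IsSONCPoint f x →
              SphereOpt.IsSOSCPoint f x ∧ SphereOpt.IsLocalMinimizer f x) ∧
    (∀ᵐ a : SphereOpt.FormIndex n d → ℝ,
      ∀ x : Fin n → ℝ, SphereOpt.IsSONCPoint (SphereOpt.formOf a) x →
        SphereOpt.IsSOSCPoint (SphereOpt.formOf a) x ∧
          SphereOpt.IsLocalMinimizer (SphereOpt.formOf a) x) := by
  refine ⟨SphereOpt.exists_isEliminationFamily n hd, fun s g hg => ⟨hg.sumSquares_ne_zero hd,
    hg.volume_zeroSet hd, fun f hf hne x hx => hg.isSOSCPoint_and_isLocalMinimizer hf hne hx⟩, ?_⟩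
  obtain ⟨s, g, hg⟩ := SphereOpt.exists_isEliminationFamily n hd
  have hae : ∀ᵐ a : SphereOpt.FormIndex n d → ℝ, aeval a (SphereOpt.sumSquares g) ≠ 0 := by
    rw [ae_iff]
    simpa using hg.volume_zeroSet hd
  filter_upwards [hae] with a ha x hx
  exact hg.isSOSCPoint_and_isLocalMinimizer (SphereOpt.formOf_isHomogeneous a)
    (by rwa [SphereOpt.coeffVec_formOf]) hx
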